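/- Let $\mathbb T=\mathbb R/\mathbb Z$, and write $|x-y|$ for the distance on $\mathbb T$. There exists a universal constant $C>0$ such that the following holds. Let $M\ge 128$ be an integer, let $J$ be a natural number, and let $s_1,\dots,s_J\in\mathbb T$ satisfy $|s_j-s_k|\ge 2/M$ for all $j\ne k$. Then for all $a,b\in\mathbb C^J$ there exists a trigonometric polynomial $f(x)=\sum_{m=-M}^{M}c_m e^{2\pi i m x}$ with $c_m\in\mathbb C$ such that $$\|f\|_{L^\infty(\mathbb T)}\le C\big(\|a\|_\infty+M^{-1}\|b\|_\infty\big),$$ and, for every $j\in\{1,\dots,J\}$ and every $x\in\mathbb T$ with $|x-s_j|\le 0.16\,M^{-1}$, $$|f(x)-a_j-b_j(x-s_j)|\le C\big(M^2\|a\|_\infty+M\|b\|_\infty\big)|x-s_j|^2.$$ Here $\|v\|_\infty=\max_j|v_j|$ for $v\in\mathbb C^J$, and in the term $b_j(x-s_j)$ the difference $x-s_j$ denotes its real representative in $(-\tfrac12,\tfrac12]$. -/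

import Mathlib

noncomputable section

/-- The trigonometric polynomials of degree (at most) `M` on the torus `ℝ/ℤ`; here
`fourier m x = exp (2πi m x)`. -/
def trigPoly (M : ℕ) : Set C(UnitAddCircle, ℂ) :=
  {f | ∃ c : ℤ → ℂ, ∀ x : UnitAddCircle,
    f x = ∑ m ∈ Finset.Icc (-(M : ℤ)) (M : ℤ), c m * fourier m x}

/-- The minimum separation condition: distinct indices give points whose distance on the torus
is at least `2 / M`. -/
def MinSeparation (M : ℕ) {J : ℕ} (s : Fin J → UnitAddCircle) : Prop :=
  ∀ j k : Fin J, j ≠ k → 2 / (M : ℝ) ≤ dist (s j) (s k)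

/-- The closed neighbourhood of radius `0.16 / M` of the `j`-th point. -/
def nbhd (M : ℕ) {J : ℕ} (s : Fin J → UnitAddCircle) (j : Fin J) : Set UnitAddCircle :=
  {x | dist x (s j) ≤ 0.16 / (M : ℝ)}

/-- The representative in `(-1/2, 1/2]` of a point of the torus. It gives a meaning to
the real number `x - s` for points `x`, `s` of the torus that are close to each other. -/
def signedRep (x : UnitAddCircle) : ℝ :=
  (AddCircle.equivIoc (1 : ℝ) (-(1 / 2)) x : ℝ)

end

/-! The idea is Hermite interpolation at the nodes with bounded, localized building blocks.

Let `F_n` be the Fejér kernel normalised to `1` at `0`. For `N ≥ 0.46 M` the matrix `F_N(s_i - s_k)`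
is strictly diagonally dominant, uniformly in `J`: separation `2/M` and the quadratic decay of `F_N`
compare an off-diagonal row sum with `∑ 1/m²`. Inverting it gives bounded Lagrange functions `G_j`
(`exists_lagrange`). This works as soon as `N/M > π/(4√3) ≈ 0.453`; being below `1/2`, the threshold
leaves room for the square of `G_j` in degree `M`.

The square has double zeros at the other nodes. A factor `F_n(x - s_j)` with `n ≈ M/25` makes the
sum over `j` bounded, and a factor linear in `(e^{2πi n (x - s_j)} - 1)/(2πi n)` sets value and
slope at `s_j` (`exists_hermite_localized`). Summing over `j` gives `f` with the prescribed values
and derivatives and the required sup norm.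

Bernstein's inequality, applied twice, bounds `f''` by a multiple of `M² ‖f‖`, and Taylor's formula
gives the quadratic error. -/

/-! ### Algebra and derivatives of trigonometric polynomials -/

/-- The space of trigonometric polynomials of degree at most `L`, as a submodule. -/
noncomputable def trigSubmodule (L : ℕ) : Submodule ℂ C(UnitAddCircle, ℂ) :=
  Submodule.span ℂ ((fun m : ℤ => (fourier m : C(UnitAddCircle, ℂ))) ''
    (Finset.Icc (-(L : ℤ)) (L : ℤ) : Finset ℤ))

theorem mem_trigPoly_of_mem_trigSubmodule {L : ℕ} {f : C(UnitAddCircle, ℂ)}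
    (hf : f ∈ trigSubmodule L) : f ∈ trigPoly L := by
  induction hf using Submodule.span_induction with
  | mem f hf =>
    obtain ⟨m, hm, rfl⟩ := hf
    refine ⟨Pi.single m 1, fun x => ?_⟩
    rw [Finset.sum_eq_single_of_mem m hm fun n _ hn => by rw [Pi.single_eq_of_ne hn, zero_mul],
      Pi.single_eq_same, one_mul]
  | zero => exact ⟨0, fun x => by simp⟩
  | add f₁ f₂ _ _ h₁ h₂ =>
    obtain ⟨c₁, h₁⟩ := h₁
    obtain ⟨c₂, h₂⟩ := h₂
    exact ⟨c₁ + c₂, fun x => by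
      simp only [ContinuousMap.add_apply, h₁, h₂, Pi.add_apply, add_mul, Finset.sum_add_distrib]⟩
  | smul a f _ h =>
    obtain ⟨c, h⟩ := h
    exact ⟨a • c, fun x => by
      simp only [ContinuousMap.smul_apply, h, Pi.smul_apply, smul_eq_mul, Finset.mul_sum,
        mul_assoc]⟩

theorem fourier_mem_trigSubmodule {L : ℕ} {m : ℤ} (h₁ : -(L : ℤ) ≤ m) (h₂ : m ≤ L) :
    (fourier m : C(UnitAddCircle, ℂ)) ∈ trigSubmodule L :=
  Submodule.subset_span ⟨m, by simp [h₁, h₂], rfl⟩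

theorem fourier_mul_fourier (m n : ℤ) :
    (fourier m * fourier n : C(UnitAddCircle, ℂ)) = fourier (m + n) := by
  ext x
  exact fourier_add.symm

theorem one_mem_trigSubmodule (L : ℕ) : (1 : C(UnitAddCircle, ℂ)) ∈ trigSubmodule L := by
  have : (1 : C(UnitAddCircle, ℂ)) = fourier 0 := by ext x; simp
  rw [this]
  exact fourier_mem_trigSubmodule (by simp) (by simp)

theorem trigSubmodule_mono {L L' : ℕ} (h : L ≤ L') : trigSubmodule L ≤ trigSubmodule L' := by
  refine Submodule.span_mono (Set.image_mono ?_)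
  intro m hm
  simp only [Finset.coe_Icc, Set.mem_Icc] at hm ⊢
  omega

theorem mul_mem_trigSubmodule {L L' : ℕ} {f g : C(UnitAddCircle, ℂ)}
    (hf : f ∈ trigSubmodule L) (hg : g ∈ trigSubmodule L') : f * g ∈ trigSubmodule (L + L') := by
  have h := Submodule.mul_mem_mul hf hg
  rw [trigSubmodule, trigSubmodule, Submodule.span_mul_span] at h
  refine Submodule.span_mono ?_ h
  rintro _ ⟨_, ⟨m, hm, rfl⟩, _, ⟨n, hn, rfl⟩, rfl⟩
  simp only [Finset.coe_Icc, Set.mem_Icc] at hm hn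
  refine ⟨m + n, ?_, (fourier_mul_fourier m n).symm⟩
  simp only [Finset.coe_Icc, Set.mem_Icc]
  push_cast
  omega

theorem exists_hasDerivAt_of_mem_trigSubmodule {L : ℕ} {f : C(UnitAddCircle, ℂ)}
    (hf : f ∈ trigSubmodule L) :
    ∃ g ∈ trigSubmodule L, ∀ t : ℝ, HasDerivAt (fun u : ℝ => f (u : UnitAddCircle)) (g t) t := by
  induction hf using Submodule.span_induction with
  | mem f hf =>
    obtain ⟨m, hm, rfl⟩ := hf
    refine ⟨(2 * Real.pi * Complex.I * m) • fourier m,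
      Submodule.smul_mem _ _ (Submodule.subset_span ⟨m, hm, rfl⟩), fun t => ?_⟩
    have := hasDerivAt_fourier (1 : ℝ) m t
    simpa [-fourier_apply] using this
  | zero => exact ⟨0, Submodule.zero_mem _, fun t => by simpa using hasDerivAt_const t (0 : ℂ)⟩
  | add f₁ f₂ _ _ h₁ h₂ =>
    obtain ⟨g₁, hg₁, h₁⟩ := h₁
    obtain ⟨g₂, hg₂, h₂⟩ := h₂
    exact ⟨g₁ + g₂, Submodule.add_mem _ hg₁ hg₂, fun t => (h₁ t).add (h₂ t)⟩
  | smul c f _ h =>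
    obtain ⟨g, hg, h⟩ := h
    exact ⟨c • g, Submodule.smul_mem _ _ hg, fun t => (h t).const_smul c⟩

/-! ### Bernstein's inequality -/

-- Turns bounds on the circle into bounds for an algebraic polynomial on `‖w‖ = 1`, where the
-- maximum principle and Cauchy's estimate apply.
open Polynomial in
theorem exists_polynomial_of_mem_trigSubmodule {L : ℕ} {f : C(UnitAddCircle, ℂ)}
    (hf : f ∈ trigSubmodule L) :
    ∃ p : ℂ[X], p.natDegree ≤ 2 * L ∧
      ∀ x, f x = fourier (-(L : ℤ)) x * p.eval (fourier 1 x : ℂ) := by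
  induction hf using Submodule.span_induction with
  | mem f hf =>
    obtain ⟨m, hm, rfl⟩ := hf
    simp only [Finset.coe_Icc, Set.mem_Icc] at hm
    obtain ⟨k, hk⟩ : ∃ k : ℕ, m + L = k := Int.eq_ofNat_of_zero_le (by omega)
    refine ⟨X ^ k, by rw [natDegree_X_pow]; omega, fun x => ?_⟩
    have hpow : (fourier 1 x : ℂ) ^ k = fourier (k : ℤ) x := by
      simp [fourier_apply, AddCircle.toCircle_nsmul]
    rw [eval_pow, eval_X, hpow, ← fourier_add, ← hk]
    congr 2
    ring
  | zero => exact ⟨0, by simp, fun x => by simp⟩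
  | add f₁ f₂ _ _ h₁ h₂ =>
    obtain ⟨p₁, hp₁, h₁⟩ := h₁
    obtain ⟨p₂, hp₂, h₂⟩ := h₂
    exact ⟨p₁ + p₂, natDegree_add_le_of_degree_le hp₁ hp₂, fun x => by
      rw [eval_add, mul_add, ← h₁, ← h₂, ContinuousMap.add_apply]⟩
  | smul c f _ h =>
    obtain ⟨p, hp, h⟩ := h
    exact ⟨c • p, (natDegree_smul_le c p).trans hp, fun x => by
      rw [eval_smul, mul_smul_comm, ← h, ContinuousMap.smul_apply]⟩

open Polynomial Metric in
theorem Polynomial.norm_eval_le_of_norm_le_one {p : ℂ[X]} {B : ℝ}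
    (hB : ∀ w : ℂ, ‖w‖ = 1 → ‖p.eval w‖ ≤ B) {w : ℂ} (hw : ‖w‖ ≤ 1) : ‖p.eval w‖ ≤ B := by
  refine Complex.norm_le_of_forall_mem_frontier_norm_le (U := ball (0 : ℂ) 1) isBounded_ball
    p.differentiable.diffContOnCl (fun z hz => hB z ?_) ?_
  · rw [frontier_ball (0 : ℂ) one_ne_zero] at hz
    simpa using hz
  · rw [closure_ball (0 : ℂ) one_ne_zero]
    simpa using hw

-- The reversed polynomial `z ^ n * p(1/z)` obeys the same bound on the unit circle, so the maximum
-- principle inside the disc controls `p` outside it.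
open Polynomial in
theorem Polynomial.norm_eval_le_pow_mul_of_one_le_norm {p : ℂ[X]} {n : ℕ} (hn : p.natDegree ≤ n)
    {B : ℝ} (hB : ∀ w : ℂ, ‖w‖ = 1 → ‖p.eval w‖ ≤ B) {w : ℂ} (hw : 1 ≤ ‖w‖) :
    ‖p.eval w‖ ≤ ‖w‖ ^ n * B := by
  have key : ∀ z : ℂ, z ≠ 0 → p.eval z = (reflect n p).eval z⁻¹ * z ^ n := by
    intro z hz
    let := invertibleOfNonzero hz
    have := eval₂_reflect_mul_pow (RingHom.id ℂ) z n p hn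
    rw [invOf_eq_inv] at this
    simpa [eval₂_id] using this.symm
  have hw0 : w ≠ 0 := norm_pos_iff.1 (by linarith)
  have hrefl : ∀ z : ℂ, ‖z‖ = 1 → ‖(reflect n p).eval z‖ ≤ B := by
    intro z hz
    have hz0 : z ≠ 0 := norm_pos_iff.1 (by linarith)
    have h := key z⁻¹ (inv_ne_zero hz0)
    have h' := hB z⁻¹ (by simp [hz])
    rw [h, inv_inv, norm_mul, norm_pow, norm_inv, hz] at h'
    simpa using h'
  rw [key w hw0, norm_mul, norm_pow, mul_comm]
  gcongr
  exact norm_eval_le_of_norm_le_one hrefl (by rw [norm_inv]; exact inv_le_one_of_one_le₀ hw)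

open Polynomial Metric in
/-- A weak form of Bernstein's inequality on the unit circle. -/
theorem Polynomial.norm_eval_derivative_le {p : ℂ[X]} {n : ℕ} (hn : p.natDegree ≤ n) (hn0 : 0 < n)
    {B : ℝ} (hB : ∀ w : ℂ, ‖w‖ = 1 → ‖p.eval w‖ ≤ B) {w : ℂ} (hw : ‖w‖ = 1) :
    ‖p.derivative.eval w‖ ≤ 3 * n * B := by
  have hB0 : 0 ≤ B := (norm_nonneg _).trans (hB 1 (by simp))
  have hnR : (0 : ℝ) < n := by exact_mod_cast hn0
  have hexp : (1 + 1 / (n : ℝ)) ^ n ≤ 3 := by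
    have h1 : 1 + 1 / (n : ℝ) ≤ Real.exp (1 / n) := by
      rw [add_comm]; exact Real.add_one_le_exp _
    calc (1 + 1 / (n : ℝ)) ^ n ≤ Real.exp (1 / n) ^ n := by gcongr
      _ = Real.exp 1 := by rw [← Real.exp_nat_mul]; congr 1; field_simp
      _ ≤ 3 := by linarith [Real.exp_one_lt_d9]
  -- Cauchy's estimate is used at radius `1 / n`, where the growth factor `(1 + 1/n) ^ n` stays
  -- below `e < 3`.
  have hbound : ∀ z ∈ sphere w (1 / (n : ℝ)), ‖p.eval z‖ ≤ 3 * B := by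
    intro z hz
    rw [mem_sphere, dist_eq_norm] at hz
    rcases le_total ‖z‖ 1 with h | h
    · linarith [norm_eval_le_of_norm_le_one hB h]
    · have hz' : ‖z‖ ≤ 1 + 1 / (n : ℝ) := by
        have := norm_add_le w (z - w)
        rw [add_sub_cancel, hz, hw] at this
        exact this
      calc ‖p.eval z‖ ≤ ‖z‖ ^ n * B := norm_eval_le_pow_mul_of_one_le_norm hn hB h
        _ ≤ (1 + 1 / (n : ℝ)) ^ n * B := by gcongr
        _ ≤ 3 * B := by gcongr
  have := Complex.norm_deriv_le_of_forall_mem_sphere_norm_le (by positivity)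
    (p.differentiable.diffContOnCl (s := ball w (1 / (n : ℝ)))) hbound
  rw [Polynomial.deriv] at this
  calc ‖p.derivative.eval w‖ ≤ 3 * B / (1 / n) := this
    _ = 3 * n * B := by field_simp

/-- A weak form of Bernstein's inequality for trigonometric polynomials. -/
theorem exists_hasDerivAt_norm_le {L : ℕ} (hL : 0 < L) {f : C(UnitAddCircle, ℂ)}
    (hf : f ∈ trigSubmodule L) :
    ∃ g ∈ trigSubmodule L, (∀ t : ℝ, HasDerivAt (fun u : ℝ => f (u : UnitAddCircle)) (g t) t) ∧
      ‖g‖ ≤ 45 * L * ‖f‖ := by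
  obtain ⟨g, hg, hfg⟩ := exists_hasDerivAt_of_mem_trigSubmodule hf
  refine ⟨g, hg, hfg, ?_⟩
  obtain ⟨p, hp, hfp⟩ := exists_polynomial_of_mem_trigSubmodule hf
  have hunit : ∀ (m : ℤ) (x : UnitAddCircle), ‖(fourier m x : ℂ)‖ = 1 := fun m x =>
    Circle.norm_coe _
  have hB : ∀ w : ℂ, ‖w‖ = 1 → ‖p.eval w‖ ≤ ‖f‖ := by
    intro w hw
    obtain ⟨x, hx⟩ : ∃ x : UnitAddCircle, (fourier 1 x : ℂ) = w := by
      obtain ⟨x, hx⟩ := (AddCircle.homeomorphCircle (one_ne_zero (α := ℝ))).surjective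
        ⟨w, mem_sphere_zero_iff_norm.2 hw⟩
      refine ⟨x, ?_⟩
      rw [fourier_one, ← AddCircle.homeomorphCircle_apply one_ne_zero, hx]
    have h := f.norm_coe_le_norm x
    rwa [hfp x, norm_mul, hunit, one_mul, hx] at h
  rw [ContinuousMap.norm_le _ (by positivity)]
  intro x
  obtain ⟨t, rfl⟩ := QuotientAddGroup.mk_surjective x
  have h1 := hasDerivAt_fourier (1 : ℝ) 1 t
  have hL' := hasDerivAt_fourier (1 : ℝ) (-(L : ℤ)) t
  have h := hL'.mul ((p.hasDerivAt (fourier 1 (t : UnitAddCircle) : ℂ)).comp t h1)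
  have heq := (hfg t).unique (h.congr_of_eventuallyEq
    (Filter.Eventually.of_forall fun u => hfp u))
  have hpi := Real.pi_lt_d2
  change ‖g (t : UnitAddCircle)‖ ≤ _
  rw [heq]
  have e1 : ‖p.eval (fourier 1 (t : UnitAddCircle) : ℂ)‖ ≤ ‖f‖ := hB _ (hunit _ _)
  have e2 := Polynomial.norm_eval_derivative_le hp (by omega) hB
    (hunit 1 (t : UnitAddCircle))
  refine (norm_add_le _ _).trans ?_
  simp only [Function.comp_apply, norm_mul, hunit, Complex.norm_I, norm_div, Complex.norm_real,
    Int.cast_neg, norm_neg, Int.cast_natCast, Complex.norm_natCast]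
  simp only [Complex.norm_ofNat, norm_one, Int.cast_one,
    mul_one, one_mul, div_one, Real.norm_of_nonneg Real.pi_pos.le]
  push_cast at e2
  -- Product rule for `e^{-2πiLt} p(e^{2πit})` with `deg p ≤ 2L`; the constant is `14π < 45`.
  calc _ ≤ 2 * Real.pi * L * ‖f‖ + 3 * (2 * L) * ‖f‖ * (2 * Real.pi) := by gcongr
    _ = 14 * Real.pi * (L * ‖f‖) := by ring
    _ ≤ 45 * (L * ‖f‖) := by gcongr; linarith
    _ = 45 * L * ‖f‖ := by ring

/-! ### Signed representatives and sums over separated points -/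

theorem coe_signedRep (x : UnitAddCircle) : ((signedRep x : ℝ) : UnitAddCircle) = x :=
  AddCircle.coe_equivIoc

theorem abs_signedRep_le (x : UnitAddCircle) : |signedRep x| ≤ 1 / 2 := by
  have h := (AddCircle.equivIoc (1 : ℝ) (-(1 / 2)) x).2
  rw [abs_le]
  constructor
  · exact h.1.le
  · have := h.2
    unfold signedRep
    linarith

theorem abs_signedRep (x : UnitAddCircle) : |signedRep x| = ‖x‖ := by
  have h := (AddCircle.norm_coe_eq_abs_iff (1 : ℝ) (x := signedRep x) one_ne_zero).2
    (by simpa using abs_signedRep_le x)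
  rw [← h]
  exact congrArg norm (coe_signedRep x)

theorem norm_coe_le_abs (t : ℝ) : ‖(t : UnitAddCircle)‖ ≤ |t| := by
  rw [UnitAddCircle.norm_eq]
  simpa using round_le t 0

/-- Points of the circle that are `δ`-separated have, on each side of a given point `x`, at most
one member at distance in `[m δ, (m + 1) δ)` from `x`. -/
theorem sum_le_two_mul_tsum_of_separated {ι : Type*} {δ : ℝ} (hδ : 0 < δ)
    {s : ι → UnitAddCircle} (hs : ∀ i j, i ≠ j → δ ≤ dist (s i) (s j)) (x : UnitAddCircle)
    (S : Finset ι) {v : ι → ℝ} {φ : ℕ → ℝ} (hφ : ∀ m, 0 ≤ φ m) (hsum : Summable φ)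
    (hv : ∀ i ∈ S, v i ≤ φ ⌊‖x - s i‖ / δ⌋₊) : ∑ i ∈ S, v i ≤ 2 * ∑' m, φ m := by
  -- On one side of `x`, two points with the same floor would be less than `δ` apart, so the floor
  -- is injective there.
  have side : ∀ T : Finset ι,
      (∀ i ∈ T, ∀ j ∈ T, (0 < signedRep (x - s i) ↔ 0 < signedRep (x - s j))) →
      ∑ i ∈ T, φ ⌊‖x - s i‖ / δ⌋₊ ≤ ∑' m, φ m := by
    intro T hT
    have hinj : Set.InjOn (fun i => ⌊‖x - s i‖ / δ⌋₊) (T : Set ι) := by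
      intro i hi j hj hij
      by_contra hne
      obtain ⟨m, h1, h2⟩ : ∃ m, ⌊‖x - s i‖ / δ⌋₊ = m ∧ ⌊‖x - s j‖ / δ⌋₊ = m := ⟨_, hij, rfl⟩
      rw [Nat.floor_eq_iff (by positivity)] at h1 h2
      rw [le_div_iff₀ hδ, div_lt_iff₀ hδ, ← abs_signedRep] at h1 h2
      have hd : δ ≤ |signedRep (x - s j) - signedRep (x - s i)| := by
        refine (hs i j hne).trans ?_
        rw [dist_eq_norm]
        refine le_trans (le_of_eq ?_) (norm_coe_le_abs _)
        rw [AddCircle.coe_sub, coe_signedRep, coe_signedRep]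
        congr 1
        abel
      have hsign := hT i hi j hj
      have hlt : |signedRep (x - s j) - signedRep (x - s i)| < δ := by
        by_cases hpos : 0 < signedRep (x - s i)
        · have hpos' := hsign.1 hpos
          rw [abs_of_pos hpos] at h1
          rw [abs_of_pos hpos'] at h2
          rw [abs_lt]
          constructor <;> linarith
        · have hpos' : ¬ 0 < signedRep (x - s j) := fun h => hpos (hsign.2 h)
          rw [abs_of_nonpos (not_lt.1 hpos)] at h1
          rw [abs_of_nonpos (not_lt.1 hpos')] at h2
          rw [abs_lt]
          constructor <;> linarith
      linarith
    classical
    rw [← Finset.sum_image hinj]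
    exact hsum.sum_le_tsum _ fun m _ => hφ m
  classical
  calc ∑ i ∈ S, v i ≤ ∑ i ∈ S, φ ⌊‖x - s i‖ / δ⌋₊ := Finset.sum_le_sum hv
    _ = ∑ i ∈ S with 0 < signedRep (x - s i), φ ⌊‖x - s i‖ / δ⌋₊ +
        ∑ i ∈ S with ¬ 0 < signedRep (x - s i), φ ⌊‖x - s i‖ / δ⌋₊ :=
      (Finset.sum_filter_add_sum_filter_not _ _ _).symm
    _ ≤ ∑' m, φ m + ∑' m, φ m := by
      refine add_le_add (side _ ?_) (side _ ?_)
      · intro i hi j hj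
        simp [(Finset.mem_filter.1 hi).2, (Finset.mem_filter.1 hj).2]
      · intro i hi j hj
        simp only [(Finset.mem_filter.1 hi).2, (Finset.mem_filter.1 hj).2]
    _ = 2 * ∑' m, φ m := by ring

/-! ### The Fejér kernel: decay and sums over the nodes -/

/-- The value at `y` of the Fejér kernel of order `N`, normalised to be `1` at the origin. -/
noncomputable def fejerValue (N : ℕ) (y : UnitAddCircle) : ℝ :=
  ‖(N : ℂ)⁻¹ * ∑ l ∈ Finset.range N, (fourier (l : ℤ) y : ℂ)‖ ^ 2

/-- The translate to `s` of the normalised Fejér kernel of order `N`. -/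
noncomputable def fejer (N : ℕ) (s : UnitAddCircle) : C(UnitAddCircle, ℂ) :=
  ∑ l ∈ Finset.range N, ∑ l' ∈ Finset.range N,
    ((N : ℂ)⁻¹ ^ 2 * fourier ((l : ℤ) - l') (-s)) • fourier ((l : ℤ) - l')

theorem fourier_add_arg (m : ℤ) (x y : UnitAddCircle) :
    (fourier m (x + y) : ℂ) = fourier m x * fourier m y := by
  simp only [fourier_apply, smul_add, AddCircle.toCircle_add, Circle.coe_mul]

theorem norm_fourier_apply (m : ℤ) (x : UnitAddCircle) : ‖(fourier m x : ℂ)‖ = 1 :=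
  Circle.norm_coe _

theorem fejer_mem_trigSubmodule (N : ℕ) (s : UnitAddCircle) :
    fejer N s ∈ trigSubmodule (N - 1) := by
  refine Submodule.sum_mem _ fun l hl => Submodule.sum_mem _ fun l' hl' =>
    Submodule.smul_mem _ _ (fourier_mem_trigSubmodule ?_ ?_)
  all_goals
    rw [Finset.mem_range] at hl hl'
    omega

theorem fejer_apply (N : ℕ) (s x : UnitAddCircle) :
    fejer N s x = (fejerValue N (x - s) : ℂ) := by
  have hconj : ∀ l l' : ℕ, (fourier ((l : ℤ) - l') (x - s) : ℂ) =
      fourier (l : ℤ) (x - s) * (starRingEnd ℂ) (fourier (l' : ℤ) (x - s)) := by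
    intro l l'
    rw [← fourier_neg, ← fourier_add, sub_eq_add_neg]
  rw [fejerValue, Complex.ofReal_pow, ← Complex.mul_conj', fejer]
  simp only [ContinuousMap.sum_apply, ContinuousMap.smul_apply, smul_eq_mul]
  rw [map_mul, map_sum, map_inv₀, Complex.conj_natCast, mul_mul_mul_comm, Finset.sum_mul_sum,
    Finset.mul_sum]
  refine Finset.sum_congr rfl fun l _ => ?_
  rw [Finset.mul_sum]
  refine Finset.sum_congr rfl fun l' _ => ?_
  rw [← hconj, sub_eq_add_neg x s, fourier_add_arg]
  ring

theorem fejerValue_nonneg (N : ℕ) (y : UnitAddCircle) : 0 ≤ fejerValue N y := sq_nonneg _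

theorem fejerValue_zero {N : ℕ} (hN : 0 < N) : fejerValue N 0 = 1 := by
  have : (N : ℂ) ≠ 0 := by exact_mod_cast hN.ne'
  simp [fejerValue, this]

theorem norm_fejer_apply (N : ℕ) (s x : UnitAddCircle) : ‖fejer N s x‖ = fejerValue N (x - s) := by
  rw [fejer_apply, Complex.norm_real, Real.norm_of_nonneg (fejerValue_nonneg _ _)]

theorem fejerValue_le_one {N : ℕ} (hN : 0 < N) (y : UnitAddCircle) : fejerValue N y ≤ 1 := by
  have hN' : (0 : ℝ) < N := by exact_mod_cast hN
  refine pow_le_one₀ (norm_nonneg _) ?_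
  rw [norm_mul, norm_inv, Complex.norm_natCast, inv_mul_le_iff₀ hN', mul_one]
  refine (norm_sum_le _ _).trans ?_
  simp only [norm_fourier_apply]
  simp

/-- The chord has length `2 |sin πt|`, and Jordan's inequality gives `|sin πt| ≥ 2|t|` for `|t| ≤
1/2`. -/
theorem four_mul_norm_le_norm_fourier_sub_one (y : UnitAddCircle) :
    4 * ‖y‖ ≤ ‖(fourier 1 y : ℂ) - 1‖ := by
  have hpi := Real.pi_pos
  have h := abs_signedRep_le y
  rw [← abs_signedRep y]
  conv_rhs => rw [← coe_signedRep y]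
  generalize signedRep y = t at *
  rw [fourier_coe_apply]
  have e : (2 * Real.pi * Complex.I * (1 : ℤ) * t / (1 : ℝ) : ℂ) =
      Complex.I * ((2 * Real.pi * t : ℝ) : ℂ) := by
    push_cast
    ring
  rw [e, Complex.norm_exp_I_mul_ofReal_sub_one]
  have hs : 2 / Real.pi * |Real.pi * t| ≤ |Real.sin (Real.pi * t)| := by
    apply Real.mul_abs_le_abs_sin
    rw [abs_mul, abs_of_pos hpi]
    nlinarith
  rw [abs_mul, abs_of_pos hpi, ← mul_assoc, div_mul_cancel₀ _ hpi.ne'] at hs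
  rw [show 2 * Real.pi * t / 2 = Real.pi * t by ring, norm_mul, Real.norm_eq_abs, Real.norm_eq_abs,
    abs_two]
  linarith

/-- Sum the geometric series: its numerator is at most `2`, its denominator at least `4‖y‖`. -/
theorem fejerValue_le {N : ℕ} (hN : 0 < N) {y : UnitAddCircle} (hy : 0 < ‖y‖) :
    fejerValue N y ≤ (1 / (2 * N * ‖y‖)) ^ 2 := by
  have hN' : (0 : ℝ) < N := by exact_mod_cast hN
  refine pow_le_pow_left₀ (norm_nonneg _) ?_ 2
  have hz := four_mul_norm_le_norm_fourier_sub_one y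
  have hpow : ∀ l : ℕ, (fourier (l : ℤ) y : ℂ) = (fourier 1 y : ℂ) ^ l := by
    intro l
    simp [fourier_apply, AddCircle.toCircle_nsmul]
  have hgeom := geom_sum_mul (fourier 1 y : ℂ) N
  simp only [hpow]
  have hnorm := congrArg norm hgeom
  rw [norm_mul] at hnorm
  have h2 : ‖(fourier 1 y : ℂ) ^ N - 1‖ ≤ 2 := by
    refine (norm_sub_le _ _).trans ?_
    rw [norm_pow, norm_fourier_apply]
    norm_num
  rw [norm_mul, norm_inv, Complex.norm_natCast, le_div_iff₀ (by positivity)]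
  have key : ‖∑ i ∈ Finset.range N, (fourier 1 y : ℂ) ^ i‖ * (4 * ‖y‖) ≤ 2 :=
    (mul_le_mul_of_nonneg_left hz (norm_nonneg _)).trans (hnorm.le.trans h2)
  calc _ = (N : ℝ)⁻¹ * N * (‖∑ i ∈ Finset.range N, (fourier 1 y : ℂ) ^ i‖ * (4 * ‖y‖)) / 2 := by
        ring
    _ ≤ 1 := by rw [inv_mul_cancel₀ hN'.ne']; linarith

theorem sum_fejerValue_erase_le {M N : ℕ} (hM : 0 < M) (hN : 0.46 * (M : ℝ) ≤ N) {J : ℕ}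
    {s : Fin J → UnitAddCircle} (hs : MinSeparation M s) (i : Fin J) :
    ∑ k ∈ Finset.univ.erase i, fejerValue N (s i - s k) ≤ 0.98 := by
  have hM' : (0 : ℝ) < M := by exact_mod_cast hM
  have hN' : (0 : ℝ) < N := by linarith
  -- At distance at least `2m/M` the kernel is at most `(1/(1.84 m))²`, as `2 · 0.46 · 2 = 1.84`;
  -- and `2 · (π²/6)/1.84² < 0.98`. The term `m = 0` is `1/0 = 0`, which is harmless since
  -- separation forces `m ≥ 1`.
  have hzeta := hasSum_zeta_two.mul_left (1 / 1.84 ^ 2 : ℝ)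
  have h := sum_le_two_mul_tsum_of_separated (δ := 2 / (M : ℝ)) (by positivity) hs (s i)
    (Finset.univ.erase i) (v := fun k => fejerValue N (s i - s k))
    (φ := fun m => 1 / 1.84 ^ 2 * (1 / (m : ℝ) ^ 2)) (fun m => by positivity) hzeta.summable ?_
  · rw [hzeta.tsum_eq] at h
    have hpi := Real.pi_lt_d2
    have hpi0 := Real.pi_pos
    norm_num at h ⊢
    nlinarith
  · intro k hk
    have hd : 2 / (M : ℝ) ≤ ‖s i - s k‖ := by
      rw [← dist_eq_norm]
      exact hs i k (Finset.ne_of_mem_erase hk).symm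
    have hd0 : 0 < ‖s i - s k‖ := lt_of_lt_of_le (by positivity) hd
    have hm1 : 1 ≤ ⌊‖s i - s k‖ / (2 / (M : ℝ))⌋₊ := by
      rw [Nat.one_le_floor_iff, le_div_iff₀ (by positivity), one_mul]
      exact hd
    have hm2 := Nat.floor_le (a := ‖s i - s k‖ / (2 / (M : ℝ))) (by positivity)
    generalize ⌊‖s i - s k‖ / (2 / (M : ℝ))⌋₊ = m at hm1 hm2
    have hm0 : (0 : ℝ) < m := by exact_mod_cast hm1
    refine (fejerValue_le (by exact_mod_cast hN') hd0).trans ?_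
    rw [le_div_iff₀ (by positivity), ← mul_div_assoc, div_le_iff₀ hM'] at hm2
    rw [show (1 : ℝ) / 1.84 ^ 2 * (1 / (m : ℝ) ^ 2) = (1 / (1.84 * m)) ^ 2 by
      rw [div_pow, mul_pow]; ring]
    have h : 1.84 * (m : ℝ) ≤ 2 * N * ‖s i - s k‖ := by
      nlinarith [mul_le_mul_of_nonneg_right hN hd0.le]
    exact pow_le_pow_left₀ (by positivity) (one_div_le_one_div_of_le (by positivity) h) 2

theorem sum_fejerValue_le {M N : ℕ} (hM : 0 < M) (hN : (M : ℝ) / 50 ≤ N) {J : ℕ}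
    {s : Fin J → UnitAddCircle} (hs : MinSeparation M s) (x : UnitAddCircle) :
    ∑ k, fejerValue N (x - s k) ≤ 2100 := by
  have hM' : (0 : ℝ) < M := by exact_mod_cast hM
  have hN' : (0 : ℝ) < N := lt_of_lt_of_le (by positivity) hN
  -- Here `x` may be near a node, so `m = 0` occurs and the series is shifted. For `m ≥ 1`, `2N ·
  -- 2m/M ≥ 2m/25 ≥ (m+1)/25`, whence `625 = 25²`; for `m = 0` the bound `1` suffices.
  have hzeta : HasSum (fun m : ℕ => 625 * (1 / ((m + 1 : ℕ) : ℝ) ^ 2))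
      (625 * (Real.pi ^ 2 / 6)) := by
    refine HasSum.mul_left _ ((hasSum_nat_add_iff (f := fun n : ℕ => 1 / (n : ℝ) ^ 2) 1).2 ?_)
    simpa using hasSum_zeta_two
  have h := sum_le_two_mul_tsum_of_separated (δ := 2 / (M : ℝ)) (by positivity) hs x
    Finset.univ (v := fun k => fejerValue N (x - s k))
    (fun m => by positivity) hzeta.summable ?_
  · rw [hzeta.tsum_eq] at h
    have hpi := Real.pi_lt_d2
    have hpi0 := Real.pi_pos
    nlinarith
  · intro k _
    have hm2 := Nat.floor_le (a := ‖x - s k‖ / (2 / (M : ℝ))) (by positivity)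
    generalize ⌊‖x - s k‖ / (2 / (M : ℝ))⌋₊ = m at hm2
    have hN0 : 0 < N := by exact_mod_cast hN'
    rcases Nat.eq_zero_or_pos m with rfl | hm
    · refine (fejerValue_le_one hN0 _).trans ?_
      norm_num
    · have hm1 : (1 : ℝ) ≤ m := by exact_mod_cast hm
      rw [le_div_iff₀ (by positivity), ← mul_div_assoc, div_le_iff₀ hM'] at hm2
      have hd0 : 0 < ‖x - s k‖ := by nlinarith
      refine (fejerValue_le hN0 hd0).trans ?_
      rw [show (625 : ℝ) * (1 / ((m + 1 : ℕ) : ℝ) ^ 2) = (1 / (((m + 1 : ℕ) : ℝ) / 25)) ^ 2 by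
        rw [div_pow, div_pow]; field_simp; norm_num]
      gcongr
      push_cast
      nlinarith

/-! ### Lagrange interpolation by diagonal dominance -/

/-- Lagrange interpolation: trigonometric polynomials, uniformly bounded, that are `1` at one of
the points and `0` at the other ones. -/
theorem exists_lagrange {M N : ℕ} (hM : 0 < M) (hN : 0.46 * (M : ℝ) ≤ N) {J : ℕ}
    {s : Fin J → UnitAddCircle} (hs : MinSeparation M s) (j : Fin J) :
    ∃ G ∈ trigSubmodule (N - 1), (∀ k, G (s k) = if k = j then 1 else 0) ∧
      ∀ x, ‖G x‖ ≤ 105000 := by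
  have hM' : (0 : ℝ) < M := by exact_mod_cast hM
  have hN' : (0 : ℝ) < N := by linarith
  have hN0 : 0 < N := by exact_mod_cast hN'
  let A : Matrix (Fin J) (Fin J) ℂ := fun i k => fejer N (s k) (s i)
  have hdiag : ∀ i, A i i = 1 := fun i => by
    simp only [A, fejer_apply, sub_self, fejerValue_zero hN0, Complex.ofReal_one]
  have hrow : ∀ i, ∑ k ∈ Finset.univ.erase i, ‖A i k‖ ≤ 0.98 := fun i => by
    simp only [A, norm_fejer_apply]
    exact sum_fejerValue_erase_le hM hN hs i
  have hdet : A.det ≠ 0 := det_ne_zero_of_sum_row_lt_diag fun i => by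
    rw [hdiag, norm_one]
    linarith [hrow i]
  obtain ⟨α, hα⟩ : ∃ α : Fin J → ℂ, A.mulVec α = Pi.single j 1 :=
    ⟨A⁻¹.mulVec (Pi.single j 1), by
      rw [Matrix.mulVec_mulVec, Matrix.mul_nonsing_inv _ (Ne.isUnit hdet), Matrix.one_mulVec]⟩
  have hαi : ∀ i, ∑ k, A i k * α k = if i = j then 1 else 0 := fun i => by
    have := congrFun hα i
    rwa [Pi.single_apply] at this
  -- Reading the system row by row bounds the sup norm of `α` by `1/(1 - 0.98) = 50`.
  have hbound : ‖α‖ ≤ 1 + 0.98 * ‖α‖ := by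
    refine (pi_norm_le_iff_of_nonneg (by positivity)).2 fun i => ?_
    have h1 := hαi i
    rw [← Finset.add_sum_erase _ _ (Finset.mem_univ i), hdiag, one_mul, ← eq_sub_iff_add_eq] at h1
    rw [h1]
    refine (norm_sub_le _ _).trans (add_le_add ?_ ?_)
    · split_ifs <;> simp
    · calc ‖∑ k ∈ Finset.univ.erase i, A i k * α k‖
          ≤ ∑ k ∈ Finset.univ.erase i, ‖A i k‖ * ‖α‖ := by
            refine norm_sum_le_of_le _ fun k _ => ?_
            rw [norm_mul]
            gcongr
            exact norm_le_pi_norm α k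
        _ ≤ 0.98 * ‖α‖ := by
            rw [← Finset.sum_mul]
            gcongr
            exact hrow i
  have hα50 : ‖α‖ ≤ 50 := by linarith
  refine ⟨∑ k, α k • fejer N (s k), Submodule.sum_mem _ fun k _ =>
    Submodule.smul_mem _ _ (fejer_mem_trigSubmodule N (s k)), fun i => ?_, fun x => ?_⟩
  · rw [← hαi i]
    simp only [ContinuousMap.sum_apply, ContinuousMap.smul_apply, smul_eq_mul, A, mul_comm]
  · simp only [ContinuousMap.sum_apply, ContinuousMap.smul_apply, smul_eq_mul]
    calc ‖∑ k, α k * fejer N (s k) x‖ ≤ ∑ k, 50 * fejerValue N (x - s k) := by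
          refine norm_sum_le_of_le _ fun k _ => ?_
          rw [norm_mul, norm_fejer_apply]
          have := fejerValue_nonneg N (x - s k)
          gcongr
          exact (norm_le_pi_norm α k).trans hα50
      _ ≤ 50 * 2100 := by
          rw [← Finset.mul_sum]
          gcongr
          exact sum_fejerValue_le hM (by linarith) hs x
      _ = 105000 := by norm_num

/-! ### First-order jets and Hermite interpolation -/

/-- The function `f` on the circle has value `a` and derivative `b` at the point `x`. -/
def HasJetAt (f : C(UnitAddCircle, ℂ)) (x : UnitAddCircle) (a b : ℂ) : Prop :=
  f x = a ∧ ∀ t : ℝ, (t : UnitAddCircle) = x → HasDerivAt (fun u : ℝ => f (u : UnitAddCircle)) b t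

namespace HasJetAt

variable {f g : C(UnitAddCircle, ℂ)} {x : UnitAddCircle} {a b a' b' : ℂ}

theorem mul (hf : HasJetAt f x a b) (hg : HasJetAt g x a' b') :
    HasJetAt (f * g) x (a * a') (b * a' + a * b') := by
  refine ⟨by rw [ContinuousMap.mul_apply, hf.1, hg.1], fun t ht => ?_⟩
  have h := (hf.2 t ht).mul (hg.2 t ht)
  rw [ht, hf.1, hg.1] at h
  exact h

theorem add (hf : HasJetAt f x a b) (hg : HasJetAt g x a' b') :
    HasJetAt (f + g) x (a + a') (b + b') :=
  ⟨by rw [ContinuousMap.add_apply, hf.1, hg.1], fun t ht => (hf.2 t ht).add (hg.2 t ht)⟩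

theorem smul (c : ℂ) (hf : HasJetAt f x a b) : HasJetAt (c • f) x (c * a) (c * b) :=
  ⟨by rw [ContinuousMap.smul_apply, hf.1, smul_eq_mul], fun t ht => (hf.2 t ht).const_smul c⟩

theorem one (x : UnitAddCircle) : HasJetAt 1 x 1 0 :=
  ⟨rfl, fun t _ => hasDerivAt_const t (1 : ℂ)⟩

theorem sum {ι : Type*} (S : Finset ι) {F : ι → C(UnitAddCircle, ℂ)} {A B : ι → ℂ}
    (h : ∀ i ∈ S, HasJetAt (F i) x (A i) (B i)) :
    HasJetAt (∑ i ∈ S, F i) x (∑ i ∈ S, A i) (∑ i ∈ S, B i) := by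
  classical
  induction S using Finset.induction_on with
  | empty => exact ⟨by simp, fun t _ => by simpa using hasDerivAt_const t (0 : ℂ)⟩
  | insert i S hi ih =>
    rw [Finset.sum_insert hi, Finset.sum_insert hi, Finset.sum_insert hi]
    exact (h i (Finset.mem_insert_self i S)).add
      (ih fun k hk => h k (Finset.mem_insert_of_mem hk))

theorem fourier (m : ℤ) (x : UnitAddCircle) :
    HasJetAt (fourier m) x (_root_.fourier m x)
      (2 * Real.pi * Complex.I * m * _root_.fourier m x) := by
  refine ⟨rfl, fun t ht => ?_⟩
  have h := hasDerivAt_fourier (1 : ℝ) m t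
  rw [ht] at h
  simpa [-fourier_apply] using h

end HasJetAt

theorem exists_hasJetAt {L : ℕ} (hL : 0 < L) {f : C(UnitAddCircle, ℂ)} (hf : f ∈ trigSubmodule L)
    (x : UnitAddCircle) : ∃ d : ℂ, HasJetAt f x (f x) d ∧ ‖d‖ ≤ 45 * L * ‖f‖ := by
  obtain ⟨g, -, hg, hgf⟩ := exists_hasDerivAt_norm_le hL hf
  refine ⟨g x, ⟨rfl, fun t ht => ?_⟩, (g.norm_coe_le_norm x).trans hgf⟩
  rw [← ht]
  exact hg t

theorem exists_linear_jet {n : ℕ} (hn : 0 < n) (s : UnitAddCircle) :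
    ∃ τ ∈ trigSubmodule n, HasJetAt τ s 0 1 ∧ ∀ x, ‖τ x‖ ≤ 1 / (3 * n) := by
  have hn' : (0 : ℝ) < n := by exact_mod_cast hn
  have hnC : (n : ℂ) ≠ 0 := by exact_mod_cast hn.ne'
  have hpi : (Real.pi : ℂ) ≠ 0 := by exact_mod_cast Real.pi_ne_zero
  have hinv : (fourier (n : ℤ) (-s) : ℂ) * fourier (n : ℤ) s = 1 := by
    rw [← fourier_add_arg, neg_add_cancel, fourier_eval_zero]
  refine ⟨(2 * Real.pi * Complex.I * n : ℂ)⁻¹ •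
    ((fourier (n : ℤ) (-s) : ℂ) • fourier (n : ℤ) + (-1 : ℂ) • 1), ?_, ?_, fun x => ?_⟩
  · exact Submodule.smul_mem _ _ (Submodule.add_mem _
      (Submodule.smul_mem _ _ (fourier_mem_trigSubmodule (by omega) le_rfl))
      (Submodule.smul_mem _ _ (one_mem_trigSubmodule n)))
  · convert (((HasJetAt.fourier (n : ℤ) s).smul (fourier (n : ℤ) (-s) : ℂ)).add
      ((HasJetAt.one s).smul (-1))).smul (2 * Real.pi * Complex.I * n : ℂ)⁻¹ using 1
    · rw [hinv]
      ring
    · rw [mul_left_comm (fourier (n : ℤ) (-s) : ℂ), hinv]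
      have := Complex.I_ne_zero
      push_cast
      field_simp
      ring
  · simp only [ContinuousMap.smul_apply, ContinuousMap.add_apply, smul_eq_mul,
      ContinuousMap.one_apply, norm_mul, norm_inv, Complex.norm_I, Complex.norm_ofNat,
      Complex.norm_natCast, Complex.norm_real, Real.norm_of_nonneg Real.pi_pos.le]
    have h2 : ‖(fourier (n : ℤ) (-s) : ℂ) * fourier (n : ℤ) x + -1 * 1‖ ≤ 2 := by
      refine (norm_add_le _ _).trans ?_
      rw [norm_mul, norm_fourier_apply, norm_fourier_apply]
      norm_num
    have hpi3 := Real.pi_gt_three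
    calc _ ≤ (2 * Real.pi * 1 * n)⁻¹ * 2 := by gcongr
      _ = 1 / (Real.pi * n) := by field_simp
      _ ≤ 1 / (3 * n) := by gcongr

/-- Hermite interpolation at one point, with double zeros at the other points and with the
decay of a Fejér kernel. -/
theorem exists_hermite_localized {M n : ℕ} (hn : 0 < n) (hnM : (M : ℝ) / 50 ≤ n)
    (hMn : 25 * n ≤ M) {J : ℕ} {s : Fin J → UnitAddCircle} (hs : MinSeparation M s) (j : Fin J)
    (a b : ℂ) :
    ∃ g ∈ trigSubmodule M, HasJetAt g (s j) a b ∧ (∀ k, k ≠ j → HasJetAt g (s k) 0 0) ∧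
      ∀ x, ‖g x‖ ≤ 105000 ^ 2 * (1 + 765 * 105000 ^ 2) * (‖a‖ + (M : ℝ)⁻¹ * ‖b‖) *
        fejerValue n (x - s j) := by
  have hM : 0 < M := by omega
  have hM' : (0 : ℝ) < M := by exact_mod_cast hM
  have hn' : (0 : ℝ) < n := by exact_mod_cast hn
  -- `N = ⌈0.46 M⌉`. Degree count: `2(N - 1) ≤ 0.92 M` for `G²`, and `(n - 1) + n ≤ 0.08 M` for the
  -- Fejér and linear factors.
  obtain ⟨N, hN₁, hN₂⟩ : ∃ N : ℕ, 46 * M ≤ 100 * N ∧ 100 * (N - 1) ≤ 46 * M :=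
    ⟨(46 * M + 99) / 100, by omega, by omega⟩
  have hN : 0.46 * (M : ℝ) ≤ N := by
    have : (46 : ℝ) * M ≤ 100 * N := by exact_mod_cast hN₁
    linarith
  obtain ⟨G, hGmem, hG, hGle⟩ := exists_lagrange hM hN hs j
  obtain ⟨τ, hτmem, hτ, hτle⟩ := exists_linear_jet hn (s j)
  set P : C(UnitAddCircle, ℂ) := G * (G * fejer n (s j)) with hP
  have hPmem : P ∈ trigSubmodule (N - 1 + (N - 1 + (n - 1))) :=
    mul_mem_trigSubmodule hGmem (mul_mem_trigSubmodule hGmem (fejer_mem_trigSubmodule n (s j)))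
  have hPle : ∀ x, ‖P x‖ ≤ 105000 ^ 2 * fejerValue n (x - s j) := fun x => by
    rw [hP, ContinuousMap.mul_apply, ContinuousMap.mul_apply, norm_mul, norm_mul,
      norm_fejer_apply, pow_two, mul_assoc]
    have := hGle x
    have := fejerValue_nonneg n (x - s j)
    gcongr
  have hPnorm : ‖P‖ ≤ 105000 ^ 2 := (ContinuousMap.norm_le _ (by positivity)).2 fun x =>
    (hPle x).trans (by
      have := fejerValue_le_one hn (x - s j)
      linarith)
  have hPj : P (s j) = 1 := by
    simp only [hP, ContinuousMap.mul_apply, hG, fejer_apply, sub_self, fejerValue_zero hn, if_true,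
      Complex.ofReal_one, mul_one]
  have hPk : ∀ k, k ≠ j → HasJetAt P (s k) 0 0 := fun k hk => by
    obtain ⟨d, hd, -⟩ := exists_hasJetAt hM (trigSubmodule_mono (by omega) hGmem) (s k)
    obtain ⟨e, he, -⟩ := exists_hasJetAt hM (trigSubmodule_mono (by omega)
      (fejer_mem_trigSubmodule n (s j))) (s k)
    rw [hG, if_neg hk] at hd
    simpa using hd.mul (hd.mul he)
  obtain ⟨d, hd, hdle⟩ := exists_hasJetAt hM (trigSubmodule_mono (by omega) hPmem) (s j)
  rw [hPj] at hd
  have hd' : ‖d‖ ≤ 45 * M * 105000 ^ 2 := hdle.trans (by gcongr)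
  -- `P` has value `1` and slope `d` at `s j`; subtracting `a * d` from the slope of the linear
  -- factor makes the product's slope `b`. Bernstein gives `d = O(M)` and `τ = O(1/M)`, so the
  -- correction is bounded; `765 = 45 · 17`.
  refine ⟨P * (a • 1 + (b - a * d) • τ), ?_, ?_, fun k hk => ?_, fun x => ?_⟩
  · refine trigSubmodule_mono ?_ (mul_mem_trigSubmodule hPmem (Submodule.add_mem _
      (Submodule.smul_mem _ a (one_mem_trigSubmodule n)) (Submodule.smul_mem _ (b - a * d) hτmem)))
    omega
  · convert hd.mul (((HasJetAt.one (s j)).smul a).add (hτ.smul (b - a * d))) using 1 <;> ring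
  · obtain ⟨e, he, -⟩ := exists_hasJetAt hM (trigSubmodule_mono (by omega) hτmem) (s k)
    simpa using (hPk k hk).mul (((HasJetAt.one (s k)).smul a).add (he.smul (b - a * d)))
  · have hτ' : ‖τ x‖ ≤ 17 * (M : ℝ)⁻¹ := by
      refine (hτle x).trans ?_
      rw [div_le_iff₀ (by positivity)]
      calc (1 : ℝ) = M * (M : ℝ)⁻¹ := (mul_inv_cancel₀ hM'.ne').symm
        _ ≤ 50 * n * (M : ℝ)⁻¹ := by gcongr; linarith
        _ ≤ 17 * (M : ℝ)⁻¹ * (3 * n) := by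
          have : 0 ≤ (n : ℝ) * (M : ℝ)⁻¹ := by positivity
          linarith
    have hlin : ‖a + (b - a * d) * τ x‖ ≤
        (1 + 765 * 105000 ^ 2) * (‖a‖ + (M : ℝ)⁻¹ * ‖b‖) := by
      calc ‖a + (b - a * d) * τ x‖ ≤ ‖a‖ + (‖b‖ + ‖a‖ * ‖d‖) * ‖τ x‖ := by
            refine (norm_add_le _ _).trans ?_
            rw [norm_mul]
            gcongr
            exact (norm_sub_le _ _).trans (by rw [norm_mul])
        _ ≤ ‖a‖ + (‖b‖ + ‖a‖ * (45 * M * 105000 ^ 2)) * (17 * (M : ℝ)⁻¹) := by gcongr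
        _ = (1 + 765 * 105000 ^ 2) * ‖a‖ + 17 * ((M : ℝ)⁻¹ * ‖b‖) := by
            field_simp
            ring
        _ ≤ (1 + 765 * 105000 ^ 2) * (‖a‖ + (M : ℝ)⁻¹ * ‖b‖) := by
            have : 0 ≤ (M : ℝ)⁻¹ * ‖b‖ := by positivity
            rw [mul_add]
            gcongr
            norm_num
    simp only [ContinuousMap.mul_apply, ContinuousMap.add_apply, ContinuousMap.smul_apply,
      ContinuousMap.one_apply, smul_eq_mul, mul_one, norm_mul]
    calc ‖P x‖ * ‖a + (b - a * d) * τ x‖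
        ≤ 105000 ^ 2 * fejerValue n (x - s j) *
          ((1 + 765 * 105000 ^ 2) * (‖a‖ + (M : ℝ)⁻¹ * ‖b‖)) := by
          have := fejerValue_nonneg n (x - s j)
          gcongr
          exact hPle x
      _ = _ := by ring

theorem exists_hermite_interpolation :
    ∃ C : ℝ, 0 < C ∧ ∀ M : ℕ, 128 ≤ M → ∀ (J : ℕ) (s : Fin J → UnitAddCircle),
      MinSeparation M s → ∀ a b : Fin J → ℂ, ∃ f ∈ trigSubmodule M,
        ‖f‖ ≤ C * (‖a‖ + (M : ℝ)⁻¹ * ‖b‖) ∧ ∀ j, HasJetAt f (s j) (a j) (b j) := by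
  obtain ⟨C, hC, h⟩ : ∃ C : ℝ, 0 < C ∧ C = 105000 ^ 2 * (1 + 765 * 105000 ^ 2) :=
    ⟨_, by norm_num, rfl⟩
  refine ⟨C * 2100, by positivity, fun M hM J s hs a b => ?_⟩
  have hM' : (0 : ℝ) < M := by exact_mod_cast (by omega : 0 < M)
  -- `n = ⌊M/25⌋` lies between `M/50` and `M/25` because `M` is large.
  have hn : (M : ℝ) / 50 ≤ (M / 25 : ℕ) := by
    have : (M : ℝ) ≤ 50 * (M / 25 : ℕ) := by exact_mod_cast (by omega : M ≤ 50 * (M / 25))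
    linarith
  choose g hgmem hgj hgk hgle using fun j =>
    exists_hermite_localized (by omega) hn (by omega) hs j (a j) (b j)
  simp only [← h] at hgle
  refine ⟨∑ j, g j, Submodule.sum_mem _ fun j _ => hgmem j, ?_, fun k => ?_⟩
  · refine (ContinuousMap.norm_le _ (by positivity)).2 fun x => ?_
    rw [ContinuousMap.sum_apply]
    calc ‖∑ j, g j x‖
        ≤ ∑ j, C * (‖a‖ + (M : ℝ)⁻¹ * ‖b‖) * fejerValue (M / 25) (x - s j) := by
          refine norm_sum_le_of_le _ fun j _ => (hgle j x).trans ?_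
          have := fejerValue_nonneg (M / 25) (x - s j)
          have := norm_le_pi_norm a j
          have := norm_le_pi_norm b j
          gcongr
      _ ≤ C * (‖a‖ + (M : ℝ)⁻¹ * ‖b‖) * 2100 := by
          rw [← Finset.mul_sum]
          gcongr
          exact sum_fejerValue_le (by omega) hn hs x
      _ = C * 2100 * (‖a‖ + (M : ℝ)⁻¹ * ‖b‖) := by ring
  · have key := HasJetAt.sum Finset.univ (x := s k) (F := g)
      (A := fun j => if j = k then a k else 0) (B := fun j => if j = k then b k else 0) ?_
    · simpa using key
    · intro j _
      by_cases hjk : j = k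
      · subst hjk
        simpa using hgj j
      · simpa [hjk] using hgk j k (Ne.symm hjk)

/-! ### Taylor remainder and conclusion -/

/-- The mean value inequality is used twice, first for `u'`, then for `u` minus its linear part;
this costs only the factor `1/2` of the sharp remainder. -/
theorem norm_taylor_remainder_le {u u' u'' : ℝ → ℂ} {S : ℝ} (hu : ∀ t, HasDerivAt u (u' t) t)
    (hu' : ∀ t, HasDerivAt u' (u'' t) t) (hS : ∀ t, ‖u'' t‖ ≤ S) (t₀ t : ℝ) :
    ‖u (t₀ + t) - u t₀ - u' t₀ * t‖ ≤ S * t ^ 2 := by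
  have hlip : ∀ r, ‖u' r - u' t₀‖ ≤ S * ‖r - t₀‖ := fun r =>
    convex_univ.norm_image_sub_le_of_norm_hasDerivWithin_le
      (fun x _ => (hu' x).hasDerivWithinAt) (fun x _ => hS x) (Set.mem_univ _) (Set.mem_univ _)
  have hS0 : 0 ≤ S := (norm_nonneg _).trans (hS 0)
  have hv : ∀ r, HasDerivAt (fun r : ℝ => u r - u' t₀ * r) (u' r - u' t₀) r := fun r => by
    have := (hu r).sub ((Complex.ofRealCLM.hasDerivAt (x := r)).const_mul (u' t₀))
    rw [Complex.ofRealCLM_apply, Complex.ofReal_one, mul_one] at this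
    exact this
  have h := (convex_closedBall t₀ |t|).norm_image_sub_le_of_norm_hasDerivWithin_le
    (C := S * |t|) (fun x _ => (hv x).hasDerivWithinAt) (fun x hx => (hlip x).trans (by
      rw [mem_closedBall_iff_norm] at hx
      gcongr)) (Metric.mem_closedBall_self (abs_nonneg t))
      (show t₀ + t ∈ _ by simp)
  calc ‖u (t₀ + t) - u t₀ - u' t₀ * t‖
      = ‖u (t₀ + t) - u' t₀ * (t₀ + t : ℝ) - (u t₀ - u' t₀ * t₀)‖ := by
        congr 1
        push_cast
        ring
    _ ≤ S * |t| * ‖t₀ + t - t₀‖ := h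
    _ = S * t ^ 2 := by
      rw [add_sub_cancel_left, Real.norm_eq_abs, mul_assoc, ← pow_two, sq_abs]

theorem norm_sub_jet_le {L : ℕ} (hL : 0 < L) {f : C(UnitAddCircle, ℂ)} (hf : f ∈ trigSubmodule L)
    {s : UnitAddCircle} {a b : ℂ} (hjet : HasJetAt f s a b) (x : UnitAddCircle) :
    ‖f x - a - b * (signedRep (x - s) : ℂ)‖ ≤ (45 * L) ^ 2 * ‖f‖ * dist x s ^ 2 := by
  obtain ⟨g, hg, hfg, hgle⟩ := exists_hasDerivAt_norm_le hL hf
  obtain ⟨h, -, hgh, hhle⟩ := exists_hasDerivAt_norm_le hL hg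
  obtain ⟨t₀, rfl⟩ := QuotientAddGroup.mk_surjective s
  change HasJetAt f (t₀ : UnitAddCircle) a b at hjet
  change ‖f x - a - b * (signedRep (x - (t₀ : UnitAddCircle)) : ℂ)‖ ≤
    _ * dist x (t₀ : UnitAddCircle) ^ 2
  have hS : ∀ t : ℝ, ‖h (t : UnitAddCircle)‖ ≤ (45 * L) ^ 2 * ‖f‖ := fun t =>
    calc ‖h (t : UnitAddCircle)‖ ≤ ‖h‖ := h.norm_coe_le_norm _
      _ ≤ 45 * L * (45 * L * ‖f‖) := hhle.trans (by gcongr)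
      _ = (45 * L) ^ 2 * ‖f‖ := by ring
  have key := norm_taylor_remainder_le hfg hgh hS t₀ (signedRep (x - (t₀ : UnitAddCircle)))
  rw [AddCircle.coe_add, coe_signedRep, add_sub_cancel, (hfg t₀).unique (hjet.2 t₀ rfl),
    hjet.1, ← sq_abs (signedRep _), abs_signedRep] at key
  rwa [dist_eq_norm]

theorem proposition3 :
    ∃ C : ℝ, 0 < C ∧
      ∀ M : ℕ, 128 ≤ M →
      ∀ (J : ℕ) (s : Fin J → UnitAddCircle), MinSeparation M s →
      ∀ a b : Fin J → ℂ,
        ∃ f ∈ trigPoly M,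
          ‖f‖ ≤ C * (‖a‖ + (M : ℝ)⁻¹ * ‖b‖) ∧
          ∀ j : Fin J, ∀ x ∈ nbhd M s j,
            ‖f x - a j - b j * (signedRep (x - s j) : ℂ)‖
              ≤ C * ((M : ℝ) ^ 2 * ‖a‖ + (M : ℝ) * ‖b‖) * dist x (s j) ^ 2 := by
  obtain ⟨C, hC, h⟩ := exists_hermite_interpolation
  -- `2025 = 45²`, from two applications of Bernstein's inequality.
  refine ⟨2025 * C, by positivity, fun M hM J s hs a b => ?_⟩
  obtain ⟨f, hf, hfle, hjet⟩ := h M hM J s hs a b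
  have hM' : (0 : ℝ) < M := by exact_mod_cast (by omega : 0 < M)
  refine ⟨f, mem_trigPoly_of_mem_trigSubmodule hf, hfle.trans ?_, fun j x _ => ?_⟩
  · gcongr
    linarith
  · refine (norm_sub_jet_le (by omega) hf (hjet j) x).trans ?_
    refine mul_le_mul_of_nonneg_right ?_ (sq_nonneg _)
    calc (45 * (M : ℝ)) ^ 2 * ‖f‖
        ≤ (45 * (M : ℝ)) ^ 2 * (C * (‖a‖ + (M : ℝ)⁻¹ * ‖b‖)) := by gcongr
      _ = 2025 * C * ((M : ℝ) ^ 2 * ‖a‖ + (M : ℝ) * ‖b‖) := by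
        field_simp
        ring
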